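/- Let $D=\{0,1\}$ be the two-point discrete space, $\mathfrak c=2^{\aleph_0}$, and let $D^{\mathfrak c}$ carry the product topology. A compactification of $\omega$ is a compact Hausdorff space $K$ containing the countable discrete space $\omega$ as a dense subspace; $K\setminus\omega$ is its remainder. There are $2^{\mathfrak c}$ pairwise non-homeomorphic compactifications of $\omega$ whose remainder is homeomorphic to $D^{\mathfrak c}$. More precisely, there is a family $\{Y_\alpha:\alpha<2^{\mathfrak c}\}$ of dense countable subsets of $D^{\mathfrak c}$, pairwise disjoint and pairwise non-homeomorphic (as subspaces), such that no sequence of points of $Y_\alpha$ converges in $D^{\mathfrak c}$ unless it is eventually constant, and such that the following holds. For each $\alpha$ the set $\omega$ can be decomposed into pairwise disjoint infinite sets $\omega_y$, $y\in Y_\alpha$. Choose any such decomposition for each $\alpha$, and let $$K_\alpha=\bigl(D^{\mathfrak c}\times\{\omega\}\bigr)\cup\bigcup_{y\in Y_\alpha}\{y\}\times\omega_y\ \subset\ D^{\mathfrak c}\times(\omega+1),$$ where $\omega+1$ has the order topology. Identify $n\in\omega$ with the point $(y,n)$ of $K_\alpha$ for which $n\in\omega_y$. Then $K_\alpha$ is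 a compactification of $\omega$; $x\mapsto(x,\omega)$ is a homeomorphism of $D^{\mathfrak c}$ onto its remainder; the set of points of the remainder that are limits of sequences of points of $\omega$ is exactly $Y_\alpha\times\{\omega\}$; and $K_\alpha$ and $K_\beta$ are not homeomorphic whenever $\alpha\ne\beta$. Moreover, every homeomorphism between two compactifications of $\omega$ maps the set of remainder points that are limits of sequences from $\omega$ onto the corresponding set, so that this set is a topological invariant of a compactification. -/

import Mathlib

open Set Filter Topology Cardinal

universe u v

/-- `e : ℕ → K` exhibits `K` as a (Hausdorff) compactification of the countable discrete
space `ω`. -/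
structure IsCompactificationOfOmega {K : Type u} [TopologicalSpace K] (e : ℕ → K) : Prop where
  compactSpace : CompactSpace K
  t2Space : T2Space K
  isEmbedding : IsEmbedding e
  denseRange : DenseRange e

/-- The remainder `bω \ ω` of a compactification `e : ω → bω`. -/
def remainder {K : Type u} (e : ℕ → K) : Set K :=
  (range e)ᶜ

/-- The set of points of the remainder that are limits of sequences of points of `ω`. -/
def remainderSeqLimits {K : Type u} [TopologicalSpace K] (e : ℕ → K) : Set K :=
  {x | x ∈ remainder e ∧ ∃ s : ℕ → K, (∀ k, s k ∈ range e) ∧ Tendsto s atTop (𝓝 x)}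

/-- No nontrivial (that is, not eventually constant) sequence of points of `Y` converges
in `X`. -/
def NoNontrivialConvergentSeq {X : Type u} [TopologicalSpace X] (Y : Set X) : Prop :=
  ∀ s : ℕ → X, (∀ k, s k ∈ Y) → ∀ x : X, Tendsto s atTop (𝓝 x) →
    ∃ N, ∀ n, N ≤ n → s n = s N

/-- A decomposition of `ω` into pairwise disjoint infinite sets `ω_y`, `y ∈ Y`. It is encoded by
the map `d` which sends `n` to the unique `y` with `n ∈ ω_y`, so that `ω_y = d ⁻¹' {y}`. -/
def IsInfiniteDecomposition {X : Type u} {Y : Set X} (d : ℕ → Y) : Prop :=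
  ∀ y : Y, (d ⁻¹' {y}).Infinite

/-- The set `⋃ {{y} × ω_y : y ∈ Y}` in `X × (ω + 1)`; here `ω + 1`, with the order topology,
is `ℕ∞`, and `⊤` is its last point. -/
def omegaTilde {X : Type u} {Y : Set X} (d : ℕ → Y) : Set (X × ℕ∞) :=
  ⋃ y : Y, {(y : X)} ×ˢ ((fun n : ℕ => (n : ℕ∞)) '' (d ⁻¹' {y}))

/-- The subspace `(X × {ω}) ∪ ⋃ {{y} × ω_y : y ∈ Y}` of `X × (ω + 1)`. -/
def tkachukSpace {X : Type u} {Y : Set X} (d : ℕ → Y) : Set (X × ℕ∞) :=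
  (Set.univ ×ˢ {⊤}) ∪ omegaTilde d

theorem mem_omegaTilde {X : Type u} {Y : Set X} (d : ℕ → Y) (n : ℕ) :
    ((d n : X), (n : ℕ∞)) ∈ omegaTilde d :=
  mem_iUnion.2 ⟨d n, rfl, n, rfl, rfl⟩

/-- The copy of `ω` in `tkachukSpace d`: the point `n` becomes `(y, n)`, where `n ∈ ω_y`. -/
def tkachukOmega {X : Type u} {Y : Set X} (d : ℕ → Y) (n : ℕ) : tkachukSpace d :=
  ⟨((d n : X), (n : ℕ∞)), Or.inr (mem_omegaTilde d n)⟩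

/-- The copy of `X` in `tkachukSpace d`: the point `x` becomes `(x, ω)`. -/
def tkachukTop {X : Type u} {Y : Set X} (d : ℕ → Y) (x : X) : tkachukSpace d :=
  ⟨(x, ⊤), Or.inl ⟨trivial, rfl⟩⟩

/-! In a compactification the points of `ω` are exactly the isolated points, so a homeomorphism
preserves `ω`, the remainder and its sequential limits. A sequence from `ω` tending to `(x, ω)` in
the constructed space projects to a sequence in `Y` tending to `x`; this is eventually constant, so
`x ∈ Y`. Non-homeomorphic sets `Y` thus give non-homeomorphic compactifications.

The sets `Y` are images of a single dense family `z` indexed by `ℕ × ℕ`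
(`exists_denseRange_separating`) under the maps `twist e T`, `T : I → Bool`. The `inr` coordinates
separate disjoint small index sets, which excludes convergent sequences; adding `T` to them lets a
common point of two images determine one twist from the other. The choice between `(i, false)` and
`(i, true)` makes the topology remember `T`: a homeomorphism from a fixed image induces a map of
indices, which determines the target (`twist_eq_of_homeomorph`). There are only `𝔠` such maps, so
each twist conflicts with at most `𝔠` of the `2 ^ 𝔠` others, and `exists_pairwise_not_mk_eq` selects
a conflict-free family of full size. -/

/-! ### Sequential limits in the remainder as an invariant. -/

section Invariant

variable {K L : Type*} [TopologicalSpace K] [TopologicalSpace L]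

theorem IsCompactificationOfOmega.range_eq {e : ℕ → K} (he : IsCompactificationOfOmega e) :
    range e = {x | IsOpen ({x} : Set K)} := by
  have := he.t2Space
  ext x
  constructor
  · rintro ⟨n, rfl⟩
    obtain ⟨V, hV, hVn⟩ := he.isEmbedding.isOpen_iff.1 (isOpen_discrete ({n} : Set ℕ))
    have hsub : V ⊆ {e n} := by
      calc V ⊆ closure (V ∩ range e) := he.denseRange.open_subset_closure_inter hV
        _ ⊆ closure {e n} := by
          apply closure_mono
          rintro _ ⟨hm, m, rfl⟩
          have : m ∈ e ⁻¹' V := hm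
          rw [hVn] at this
          rw [mem_singleton_iff.1 this]
          rfl
        _ = {e n} := closure_singleton
    have hn : e n ∈ V := by
      have : n ∈ e ⁻¹' V := by rw [hVn]; rfl
      exact this
    have hVn : V = {e n} := hsub.antisymm (singleton_subset_iff.2 hn)
    rwa [hVn] at hV
  · intro hx
    obtain ⟨n, hn⟩ := he.denseRange.exists_mem_open hx (singleton_nonempty x)
    exact ⟨n, hn⟩

theorem Homeomorph.image_range_omega {e : ℕ → K} {f : ℕ → L} (he : IsCompactificationOfOmega e)
    (hf : IsCompactificationOfOmega f) (F : K ≃ₜ L) (x : K) : F x ∈ range f ↔ x ∈ range e := by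
  rw [he.range_eq, hf.range_eq, mem_ofPred_eq, mem_ofPred_eq, ← F.isOpen_image, image_singleton]

theorem Homeomorph.mapsTo_remainderSeqLimits {e : ℕ → K} {f : ℕ → L}
    (he : IsCompactificationOfOmega e) (hf : IsCompactificationOfOmega f) (F : K ≃ₜ L) {x : K}
    (hx : x ∈ remainderSeqLimits e) : F x ∈ remainderSeqLimits f := by
  obtain ⟨hx, s, hs, hsx⟩ := hx
  exact ⟨fun h => hx ((F.image_range_omega he hf x).1 h), fun k => F (s k),
    fun k => (F.image_range_omega he hf _).2 (hs k), (F.continuous.tendsto x).comp hsx⟩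

theorem Homeomorph.image_remainderSeqLimits {e : ℕ → K} {f : ℕ → L}
    (he : IsCompactificationOfOmega e) (hf : IsCompactificationOfOmega f) (F : K ≃ₜ L) :
    F '' remainderSeqLimits e = remainderSeqLimits f := by
  apply Subset.antisymm
  · rintro _ ⟨x, hx, rfl⟩
    exact F.mapsTo_remainderSeqLimits he hf hx
  · intro y hy
    exact ⟨F.symm y, F.symm.mapsTo_remainderSeqLimits hf he hy, F.apply_symm_apply y⟩

end Invariant

/-! ### The compactification built from a dense set. -/

section TkachukSpace

variable {X : Type*} {Y : Set X}

theorem exists_isInfiniteDecomposition (hc : Y.Countable) (hne : Y.Nonempty) :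
    ∃ d : ℕ → Y, IsInfiniteDecomposition d := by
  have := hc.to_subtype
  have := hne.to_subtype
  obtain ⟨f, hf⟩ := exists_surjective_nat Y
  -- Forgetting one half of the pairing repeats every value infinitely often.
  refine ⟨fun n => f n.unpair.1, fun y => ?_⟩
  obtain ⟨k, rfl⟩ := hf y
  refine (infinite_range_of_injective (f := fun m => Nat.pair k m) fun a b h => ?_).mono ?_
  · simpa using h
  · rintro _ ⟨m, rfl⟩
    simp

theorem mem_tkachukSpace_coe {d : ℕ → Y} {x : X} {n : ℕ} :
    (x, (n : ℕ∞)) ∈ tkachukSpace d ↔ x = d n := by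
  constructor
  · rintro (⟨-, h⟩ | h)
    · exact absurd h (ENat.natCast_ne_top n)
    · obtain ⟨y, hy, m, hm, hmn⟩ := mem_iUnion.1 h
      have hmn : m = n := by simpa using hmn
      have hy : x = y := hy
      have hm : d m = y := hm
      rw [hy, ← hm, hmn]
  · rintro rfl
    exact (tkachukOmega d n).2

theorem mem_remainder_tkachukOmega {d : ℕ → Y} {p : tkachukSpace d} :
    p ∈ remainder (tkachukOmega d) ↔ p ∈ range (tkachukTop d) := by
  obtain ⟨⟨x, n⟩, hp⟩ := p
  induction n using ENat.recTopCoe with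
  | top =>
    refine iff_of_true ?_ ⟨x, rfl⟩
    rintro ⟨n, hn⟩
    exact ENat.natCast_ne_top n (congrArg (fun q : tkachukSpace d => q.1.2) hn)
  | coe n =>
    refine iff_of_false ?_ ?_
    · refine not_not_intro ⟨n, ?_⟩
      obtain rfl := mem_tkachukSpace_coe.1 hp
      rfl
    · rintro ⟨y, hy⟩
      exact ENat.natCast_ne_top n (congrArg (fun q : tkachukSpace d => q.1.2) hy).symm

theorem tkachukTop_injective (d : ℕ → Y) : Function.Injective (tkachukTop d) := fun _ _ h =>
  congrArg (fun q : tkachukSpace d => q.1.1) h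

variable [TopologicalSpace X]

theorem isClosed_tkachukSpace [T1Space X] (d : ℕ → Y) : IsClosed (tkachukSpace d) := by
  rw [← isOpen_compl_iff, isOpen_iff_mem_nhds]
  rintro ⟨x, n⟩ hp
  induction n using ENat.recTopCoe with
  | top => exact absurd (Or.inl ⟨trivial, rfl⟩) hp
  | coe n =>
    have hx : x ≠ d n := fun h => hp (mem_tkachukSpace_coe.2 h)
    have hopen : IsOpen (({(d n : X)}ᶜ : Set X) ×ˢ ({(n : ℕ∞)} : Set ℕ∞)) :=
      isOpen_compl_singleton.prod (ENat.isOpen_singleton (ENat.natCast_ne_top n))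
    refine mem_of_superset (hopen.mem_nhds ⟨hx, rfl⟩) ?_
    rintro ⟨y, m⟩ ⟨hy, hm⟩ hmem
    obtain rfl : m = n := hm
    exact hy (mem_tkachukSpace_coe.1 hmem)

theorem continuous_tkachukTop (d : ℕ → Y) : Continuous (tkachukTop d) :=
  (continuous_id.prodMk continuous_const).subtype_mk _

theorem IsInfiniteDecomposition.exists_tendsto {d : ℕ → Y} (hd : IsInfiniteDecomposition d)
    (y : Y) : ∃ φ : ℕ → ℕ, Tendsto (fun k => tkachukOmega d (φ k)) atTop (𝓝 (tkachukTop d y)) := by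
  refine ⟨Nat.nth (fun n => d n = y), ?_⟩
  have hinf : (Set.ofPred fun n => d n = y).Infinite := hd y
  rw [tendsto_subtype_rng]
  refine Tendsto.prodMk_nhds ?_ ?_
  · refine tendsto_const_nhds.congr fun k => ?_
    have := Nat.nth_mem_of_infinite hinf k
    simp only [this]
  · exact ENat.tendsto_natCast_nhds_top.comp (Nat.nth_strictMono hinf).tendsto_atTop

theorem isCompactificationOfOmega_tkachukOmega [CompactSpace X] [T2Space X] (hY : Dense Y)
    {d : ℕ → Y} (hd : IsInfiniteDecomposition d) :
    IsCompactificationOfOmega (tkachukOmega d) where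
  compactSpace := isCompact_iff_compactSpace.1 (isClosed_tkachukSpace d).isCompact
  t2Space := inferInstance
  isEmbedding := by
    -- The second coordinate already embeds `ω` into `ω + 1`.
    refine IsEmbedding.of_comp continuous_of_discreteTopology
      (continuous_snd.comp continuous_subtype_val) ENat.isEmbedding_natCast
  denseRange := by
    have htop : ∀ x, tkachukTop d x ∈ closure (range (tkachukOmega d)) := fun x => by
      refine closure_minimal ?_ (isClosed_closure.preimage (continuous_tkachukTop d)) (hY x)
      intro y hy
      obtain ⟨φ, hφ⟩ := hd.exists_tendsto ⟨y, hy⟩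
      exact mem_closure_of_tendsto hφ (Eventually.of_forall fun k => mem_range_self _)
    intro p
    by_cases hp : p ∈ range (tkachukOmega d)
    · exact subset_closure hp
    · obtain ⟨x, rfl⟩ := mem_remainder_tkachukOmega.1 hp
      exact htop x

theorem exists_homeomorph_remainder_tkachukOmega [CompactSpace X] [T2Space X] (d : ℕ → Y) :
    ∃ h : X ≃ₜ remainder (tkachukOmega d), ∀ x, (h x : tkachukSpace d) = tkachukTop d x := by
  let f : X → remainder (tkachukOmega d) := fun x =>
    ⟨tkachukTop d x, mem_remainder_tkachukOmega.2 ⟨x, rfl⟩⟩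
  have hf : Function.Bijective f := by
    refine ⟨fun x y h => tkachukTop_injective d (congrArg Subtype.val h), ?_⟩
    rintro ⟨p, hp⟩
    obtain ⟨x, rfl⟩ := mem_remainder_tkachukOmega.1 hp
    exact ⟨x, rfl⟩
  have hc : Continuous (Equiv.ofBijective f hf) := (continuous_tkachukTop d).subtype_mk _
  exact ⟨hc.homeoOfEquivCompactToT2, fun x => rfl⟩

theorem remainderSeqLimits_tkachukOmega [T2Space X] (hY : NoNontrivialConvergentSeq Y)
    {d : ℕ → Y} (hd : IsInfiniteDecomposition d) :
    remainderSeqLimits (tkachukOmega d) = tkachukTop d '' Y := by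
  ext p
  constructor
  · rintro ⟨hp, s, hs, hsp⟩
    obtain ⟨x, rfl⟩ := mem_remainder_tkachukOmega.1 hp
    have hmem : ∀ k, (s k).1.1 ∈ Y := fun k => by
      obtain ⟨n, hn⟩ := hs k
      rw [← hn]
      exact (d n).2
    have hlim : Tendsto (fun k => (s k).1.1) atTop (𝓝 x) :=
      ((continuous_fst.comp continuous_subtype_val).tendsto (tkachukTop d x)).comp hsp
    obtain ⟨N, hN⟩ := hY _ hmem x hlim
    have : (s N).1.1 = x := tendsto_nhds_unique
      (tendsto_const_nhds.congr' ((eventually_ge_atTop N).mono fun n hn => (hN n hn).symm)) hlim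
    exact ⟨x, this ▸ hmem N, rfl⟩
  · rintro ⟨y, hy, rfl⟩
    obtain ⟨φ, hφ⟩ := hd.exists_tendsto ⟨y, hy⟩
    exact ⟨mem_remainder_tkachukOmega.2 ⟨y, rfl⟩, _, fun k => mem_range_self _, hφ⟩

theorem isEmbedding_tkachukTop (d : ℕ → Y) : IsEmbedding (tkachukTop d) :=
  IsEmbedding.of_comp (continuous_tkachukTop d) (continuous_fst.comp continuous_subtype_val)
    IsEmbedding.id

theorem nonempty_homeomorph_of_tkachukSpace [CompactSpace X] [T2Space X] {Z : Set X}
    (hY : Dense Y) (hZ : Dense Z) (hY' : NoNontrivialConvergentSeq Y)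
    (hZ' : NoNontrivialConvergentSeq Z) {d : ℕ → Y} {d' : ℕ → Z} (hd : IsInfiniteDecomposition d)
    (hd' : IsInfiniteDecomposition d') (F : tkachukSpace d ≃ₜ tkachukSpace d') :
    Nonempty (Y ≃ₜ Z) := by
  have himage := F.image_remainderSeqLimits (isCompactificationOfOmega_tkachukOmega hY hd)
    (isCompactificationOfOmega_tkachukOmega hZ hd')
  rw [remainderSeqLimits_tkachukOmega hY' hd, remainderSeqLimits_tkachukOmega hZ' hd'] at himage
  exact ⟨((isEmbedding_tkachukTop d).homeomorphImage Y).trans <|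
    (F.image _).trans <| (Homeomorph.setCongr himage).trans
      ((isEmbedding_tkachukTop d').homeomorphImage Z).symm⟩

end TkachukSpace

/-! ### Free sets for relations with small classes. -/

section IndependentSets

/-- A relation each of whose classes is small has a free set of full cardinality. -/
theorem exists_pairwise_not_mk_eq {P : Type u} (R : P → P → Prop) (hR : ∀ p q, R p q → R q p)
    {c : Cardinal.{u}} (hc : ℵ₀ ≤ c) (hsmall : ∀ p, #{q | R p q} ≤ c) (hP : c < #P) :
    ∃ M : Set P, #M = #P ∧ M.Pairwise fun p q => ¬ R p q := by
  obtain ⟨M, hM⟩ := zorn_subset {M : Set P | M.Pairwise fun p q => ¬ R p q} fun C hC hchain =>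
    ⟨⋃₀ C, (pairwise_sUnion hchain.directedOn).2 fun s hs => hC hs, fun s => subset_sUnion_of_mem⟩
  refine ⟨M, (mk_set_le M).antisymm ?_, hM.prop⟩
  -- By maximality every point outside `M` is related to a member of `M`; a smaller `M` would have
  -- too few classes to cover `P`.
  have hcover : (univ : Set P) ⊆ M ∪ ⋃ p ∈ M, {q | R p q} := by
    intro q _
    by_contra hq
    simp only [mem_union, mem_iUnion, not_or, not_exists] at hq
    refine hq.1 (hM.le_of_ge (y := insert q M) ?_ (subset_insert q M) (mem_insert q M))
    refine pairwise_insert.2 ⟨hM.prop, fun p hp _ => ?_⟩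
    exact ⟨fun h => hq.2 p hp (hR _ _ h), fun h => hq.2 p hp h⟩
  by_contra! hlt
  have hbound : #P ≤ #M + #M * c :=
    calc #P = #(univ : Set P) := mk_univ.symm
      _ ≤ #(M ∪ ⋃ p ∈ M, {q | R p q} : Set P) := mk_le_mk_of_subset hcover
      _ ≤ #M + #(⋃ p ∈ M, {q | R p q} : Set P) := mk_union_le _ _
      _ ≤ #M + #M * c := by
        gcongr
        refine (mk_biUnion_le _ _).trans ?_
        gcongr
        exact ciSup_le' fun p => hsmall p
  have hinf : ℵ₀ ≤ #P := hc.trans hP.le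
  exact absurd hbound (not_le.2 (add_lt_of_lt hinf hlt (mul_lt_of_lt hinf hlt hP)))

end IndependentSets

/-! ### Separability of Cantor cubes and a separating dense family. -/

section DensePi

variable {C J : Type*}

theorem denseRange_pi_bool_iff {x : C → J → Bool} :
    DenseRange x ↔ ∀ (F : Finset J) (f : J → Bool), ∃ c, ∀ j ∈ F, x c j = f j := by
  constructor
  · intro h F f
    have hopen : IsOpen ((F : Set J).pi fun j => ({f j} : Set Bool)) :=
      isOpen_set_pi F.finite_toSet fun _ _ => isOpen_discrete _
    obtain ⟨c, hc⟩ := h.exists_mem_open hopen ⟨f, fun _ _ => rfl⟩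
    exact ⟨c, fun j hj => hc j hj⟩
  · intro h f
    rw [mem_closure_iff_nhds]
    intro U hU
    rw [nhds_pi, Filter.mem_pi] at hU
    obtain ⟨I, hI, t, ht, hsub⟩ := hU
    obtain ⟨c, hc⟩ := h hI.toFinset f
    refine ⟨x c, hsub fun j hj => ?_, c, rfl⟩
    rw [hc j (hI.mem_toFinset.2 hj)]
    exact mem_of_mem_nhds (ht j)

/-- The space `2^J` is separable for `|J| ≤ 𝔠`. -/
theorem exists_denseRange_nat_pi_bool {J : Type u} (hJ : #J ≤ 𝔠) :
    ∃ x : ℕ → J → Bool, DenseRange x := by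
  classical
  have hJ' : Cardinal.lift.{0} #J ≤ Cardinal.lift.{u} #ℝ := by simpa [mk_real] using hJ
  obtain ⟨g⟩ := Cardinal.lift_mk_le'.1 hJ'
  let B := TopologicalSpace.countableBasis ℝ
  have : Countable B := TopologicalSpace.countable_countableBasis ℝ
  obtain ⟨s, hs⟩ := exists_surjective_nat (Finset B)
  -- With `J` embedded in `ℝ`, the dense points are the traces of finite unions of basic open sets;
  -- these realise every pattern on a finite set.
  refine ⟨fun n j => decide (∃ b ∈ s n, g j ∈ (b : Set ℝ)), denseRange_pi_bool_iff.2 fun F f => ?_⟩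
  have hsep : ∀ j, f j = true → ∃ b : B, g j ∈ (b : Set ℝ) ∧
      ∀ i ∈ F, f i = false → g i ∉ (b : Set ℝ) := by
    intro j hj
    let E : Set ℝ := g '' {i | i ∈ F ∧ f i = false}
    have hE : IsClosed E := ((F.finite_toSet.subset fun i hi => hi.1).image g).isClosed
    have hjE : g j ∈ Eᶜ := by
      rintro ⟨i, ⟨-, hi⟩, hij⟩
      rw [g.injective hij, hj] at hi
      exact Bool.noConfusion hi
    obtain ⟨b, hb, hjb, hbE⟩ := (TopologicalSpace.isBasis_countableBasis ℝ).exists_subset_of_mem_open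
      hjE hE.isOpen_compl
    exact ⟨⟨b, hb⟩, hjb, fun i hi hfi hib => hbE hib ⟨i, ⟨hi, hfi⟩, rfl⟩⟩
  obtain ⟨b₀, hb₀, -⟩ := (TopologicalSpace.isBasis_countableBasis ℝ).exists_subset_of_mem_open
    (mem_univ (0 : ℝ)) isOpen_univ
  have : Nonempty B := ⟨⟨b₀, hb₀⟩⟩
  choose! b hb using hsep
  obtain ⟨n, hn⟩ := hs ((F.filter fun j => f j = true).image b)
  refine ⟨n, fun j hj => ?_⟩
  simp only [hn]
  cases hfj : f j with
  | true =>
    exact decide_eq_true ⟨b j, Finset.mem_image_of_mem b (Finset.mem_filter.2 ⟨hj, hfj⟩),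
      (hb j hfj).1⟩
  | false =>
    refine decide_eq_false ?_
    rintro ⟨_, hmem, hjb⟩
    obtain ⟨i, hi, rfl⟩ := Finset.mem_image.1 hmem
    exact (hb i (Finset.mem_filter.1 hi).2).2 j hj hfj hjb

/-- Infinite repetition allows finitely many bad indices to be discarded later. -/
theorem exists_frequently_nat_pi_bool {J : Type u} (hJ : #J ≤ 𝔠) :
    ∃ x : ℕ → J → Bool, ∀ (F : Finset J) (f : J → Bool), ∃ᶠ n in cofinite, ∀ j ∈ F, x n j = f j := by
  obtain ⟨x, hx⟩ := exists_denseRange_nat_pi_bool hJ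
  refine ⟨fun n => x n.unpair.1, fun F f => ?_⟩
  obtain ⟨c, hc⟩ := denseRange_pi_bool_iff.1 hx F f
  rw [frequently_cofinite_iff_infinite]
  refine (infinite_range_of_injective (f := fun m => Nat.pair c m) fun a b h => ?_).mono ?_
  · simpa using h
  · rintro _ ⟨m, rfl⟩
    simpa using hc

/-- The ideal `Fin × Fin` on `ℕ × ℕ`: almost all vertical sections are finite. -/
def FinFin (E : Set (ℕ × ℕ)) : Prop :=
  ∀ᶠ a in cofinite, (Prod.mk a ⁻¹' E).Finite

theorem FinFin.mono {E F : Set (ℕ × ℕ)} (hF : FinFin F) (h : E ⊆ F) : FinFin E :=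
  Eventually.mono hF fun _ ha => ha.subset (preimage_mono h)

theorem finFin_singleton (n : ℕ × ℕ) : FinFin {n} :=
  Eventually.of_forall fun _ => (finite_singleton n).preimage (Prod.mk_right_injective _).injOn

/-- Either all vertical sections are finite, or one infinite section serves as `E`. -/
theorem Set.Infinite.exists_finFin {B : Set (ℕ × ℕ)} (hB : B.Infinite) :
    ∃ E ⊆ B, E.Infinite ∧ FinFin E := by
  by_cases h : ∀ a, (Prod.mk a ⁻¹' B).Finite
  · exact ⟨B, Subset.rfl, hB, Eventually.of_forall h⟩
  · push Not at h
    obtain ⟨a, ha⟩ := h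
    refine ⟨Prod.mk a '' (Prod.mk a ⁻¹' B), image_preimage_subset _ _,
      ha.image (Prod.mk_right_injective a).injOn, ?_⟩
    filter_upwards [(finite_singleton a).compl_mem_cofinite] with b hb
    refine finite_empty.subset ?_
    rintro m ⟨k, -, hk⟩
    exact hb (congrArg Prod.fst hk).symm

theorem Set.Infinite.exists_disjoint_infinite {α : Type*} {B : Set α} (hB : B.Infinite) :
    ∃ E F : Set α, E ⊆ B ∧ F ⊆ B ∧ Disjoint E F ∧ E.Infinite ∧ F.Infinite := by
  obtain ⟨E, F, rfl, hdisj, hcard⟩ := hB.exists_union_disjoint_cardinal_eq_of_infinite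
  have hiff : E.Infinite ↔ F.Infinite := by
    rw [← infinite_coe_iff, ← infinite_coe_iff, Cardinal.infinite_iff, Cardinal.infinite_iff, hcard]
  rcases infinite_union.1 hB with h | h
  · exact ⟨E, F, subset_union_left, subset_union_right, hdisj, h, hiff.1 h⟩
  · exact ⟨E, F, subset_union_left, subset_union_right, hdisj, hiff.2 h, h⟩

/-- An independent family of subsets of `ℕ × ℕ` a part of which separates all disjoint
members of `FinFin`. -/
theorem exists_denseRange_separating {I J : Type u} (hI : #I = 𝔠) (hJ : #J ≤ 𝔠) :
    ∃ z : ℕ × ℕ → J ⊕ I → Bool, DenseRange z ∧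
      ∀ E F : Set (ℕ × ℕ), FinFin E → FinFin F → Disjoint E F →
        ∃ i, (∀ n ∈ E, z n (.inr i) = true) ∧ ∀ n ∈ F, z n (.inr i) = false := by
  classical
  have hcard : Cardinal.lift.{0} #I = Cardinal.lift.{u} #(Set (ℕ × ℕ) × Set (ℕ × ℕ)) := by
    simp [hI]
  obtain ⟨q⟩ := Cardinal.lift_mk_eq'.1 hcard
  have hJI : #(J ⊕ I) ≤ 𝔠 := by
    rw [mk_sum, lift_id, lift_id, hI]
    exact (add_le_add_left hJ _).trans continuum_add_self.le
  obtain ⟨x, hx⟩ := exists_frequently_nat_pi_bool hJI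
  let Q : I → Prop := fun i => FinFin (q i).1 ∧ FinFin (q i).2
  -- Start from `x a` at `(a, b)`, and overwrite coordinate `i` on the `i`-th pair of small sets to
  -- separate them.
  let z : ℕ × ℕ → J ⊕ I → Bool := fun n => Sum.elim (fun j => x n.1 (.inl j)) fun i =>
    if Q i ∧ n ∈ (q i).1 then true else if Q i ∧ n ∈ (q i).2 then false else x n.1 (.inr i)
  -- Smallness makes the overwriting invisible for generic `a`, then generic `b`, so density
  -- survives.
  have hz : ∀ k : J ⊕ I, ∀ᶠ a in cofinite, ∀ᶠ b in cofinite, z (a, b) k = x a k := by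
    rintro (j | i)
    · exact Eventually.of_forall fun a => Eventually.of_forall fun b => rfl
    · by_cases hi : Q i
      · filter_upwards [hi.1, hi.2] with a h1 h2
        filter_upwards [h1.compl_mem_cofinite, h2.compl_mem_cofinite] with b hb1 hb2
        have hb1 : (a, b) ∉ (q i).1 := hb1
        have hb2 : (a, b) ∉ (q i).2 := hb2
        simp [z, hb1, hb2]
      · refine Eventually.of_forall fun a => Eventually.of_forall fun b => ?_
        simp [z, hi]
  refine ⟨z, denseRange_pi_bool_iff.2 fun F f => ?_, fun E F hE hF hEF => ?_⟩
  · have h1 : ∀ᶠ a in cofinite, ∀ k ∈ F, ∀ᶠ b in cofinite, z (a, b) k = x a k :=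
      (Filter.eventually_all_finset F).2 fun k _ => hz k
    obtain ⟨a, ha, ha'⟩ := ((hx F f).and_eventually h1).exists
    obtain ⟨b, hb⟩ := ((Filter.eventually_all_finset F).2 ha').exists
    exact ⟨(a, b), fun k hk => (hb k hk).trans (ha k hk)⟩
  · obtain ⟨i, hi⟩ := q.surjective (E, F)
    have hQ : Q i := by simp only [Q, hi]; exact ⟨hE, hF⟩
    refine ⟨i, fun n hn => ?_, fun n hn => ?_⟩
    · simp [z, hQ, hi, hn]
    · simp [z, hQ, hi, hn, hEF.notMem_of_mem_right hn]

end DensePi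

/-! ### Twists and their recovery from the topology. -/

section TwistedFamily

variable {I κ : Type*}

/-- The map which, given `T : I → Bool`, selects the coordinate `(i, T i)` for each `i`, and adds
`T` to the remaining coordinates. -/
def twist (e : κ ≃ I ⊕ I) (T : I → Bool) (p : (I × Bool) ⊕ I → Bool) (k : κ) : Bool :=
  Sum.elim (fun i => p (.inl (i, T i))) (fun i => xor (p (.inr i)) (T i)) (e k)

theorem twist_symm_inl (e : κ ≃ I ⊕ I) (T : I → Bool) (p : (I × Bool) ⊕ I → Bool) (i : I) :
    twist e T p (e.symm (.inl i)) = p (.inl (i, T i)) := by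
  simp [twist]

theorem twist_symm_inr (e : κ ≃ I ⊕ I) (T : I → Bool) (p : (I × Bool) ⊕ I → Bool) (i : I) :
    twist e T p (e.symm (.inr i)) = xor (p (.inr i)) (T i) := by
  simp [twist]

theorem continuous_twist (e : κ ≃ I ⊕ I) (T : I → Bool) : Continuous (twist e T) := by
  refine continuous_pi fun k => ?_
  unfold twist
  rcases e k with i | i
  · exact continuous_apply _
  · exact (continuous_of_discreteTopology (f := fun b => xor b (T i))).comp (continuous_apply _)

theorem twist_surjective (e : κ ≃ I ⊕ I) (T : I → Bool) : Function.Surjective (twist e T) := by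
  intro w
  refine ⟨Sum.elim (fun j => w (e.symm (.inl j.1))) fun i => xor (w (e.symm (.inr i))) (T i), ?_⟩
  funext k
  obtain ⟨k, rfl⟩ := e.symm.surjective k
  rcases k with i | i
  · simp [twist_symm_inl]
  · simp [twist_symm_inr]

/-- Two points which differ only in a coordinate that is not selected by `T` have the same
image. -/
theorem twist_update [DecidableEq I] (e : κ ≃ I ⊕ I) (T : I → Bool) (p : (I × Bool) ⊕ I → Bool)
    (i : I) (b : Bool) : twist e T (Function.update p (.inl (i, !T i)) b) = twist e T p := by
  funext k
  obtain ⟨k, rfl⟩ := e.symm.surjective k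
  rcases k with j | j
  · rw [twist_symm_inl, twist_symm_inl, Function.update_of_ne]
    intro h
    obtain ⟨rfl, h⟩ := Prod.mk.inj (Sum.inl.inj h)
    exact (Bool.eq_not_self _).1 h
  · rw [twist_symm_inr, twist_symm_inr, Function.update_of_ne]
    exact Sum.inr_ne_inl

variable {C : Type*} {z : C → (I × Bool) ⊕ I → Bool}

theorem denseRange_twist (hz : DenseRange z) (e : κ ≃ I ⊕ I) (T : I → Bool) :
    DenseRange fun n => twist e T (z n) :=
  (twist_surjective e T).denseRange.comp hz (continuous_twist e T)

/-- In the topology of the family twisted by `T`, a coordinate not selected by `T` does not define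
an open set. -/
theorem not_isOpen_of_not_selected (hz : DenseRange z) (e : κ ≃ I ⊕ I) (T : I → Bool) (i : I)
    {V : Set (κ → Bool)} (hV : IsOpen V) :
    ¬ ∀ n, twist e T (z n) ∈ V ↔ z n (.inl (i, !T i)) = true := by
  classical
  intro h
  let W : Set ((I × Bool) ⊕ I → Bool) := {p | p (.inl (i, !T i)) = true}
  have hW : IsClopen W :=
    (isClopen_discrete ({true} : Set Bool)).preimage (continuous_apply (Sum.inl (i, !T i)))
  have hV' : IsOpen (twist e T ⁻¹' V) := hV.preimage (continuous_twist e T)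
  obtain ⟨n, hn⟩ := hz.exists_mem_open hW.isOpen ⟨fun _ => true, rfl⟩
  -- Flipping the unselected coordinate leaves the twisted image in `V` but leaves `W`; density then
  -- supplies a contradicting index.
  let p := Function.update (z n) (.inl (i, !T i)) false
  have hp : p ∈ twist e T ⁻¹' V ∩ Wᶜ := by
    constructor
    · change twist e T p ∈ V
      rw [twist_update]
      exact (h n).2 hn
    · simp [W, p]
  obtain ⟨m, hmV, hmW⟩ := hz.exists_mem_open (hV'.inter hW.isClosed.isOpen_compl) ⟨p, hp⟩
  exact hmW ((h m).1 hmV)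

/-- A homeomorphism between twisted families determines, through the permutation of indices it
induces, the target twist. -/
theorem twist_eq_of_homeomorph (hz : DenseRange z) (e : κ ≃ I ⊕ I) {T S S' : I → Bool}
    {Y : Set (κ → Bool)} (hY : ∀ n, twist e T (z n) ∈ Y)
    (g : Y ≃ₜ range fun n => twist e S (z n)) (g' : Y ≃ₜ range fun n => twist e S' (z n))
    (hrange : Y ⊆ range fun n => twist e T (z n)) {σ : C → C}
    (hinj : Function.Injective fun n => twist e S (z n))
    (hg : ∀ n, (g ⟨_, hY n⟩ : κ → Bool) = twist e S (z (σ n)))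
    (hg' : ∀ n, (g' ⟨_, hY n⟩ : κ → Bool) = twist e S' (z (σ n))) : S = S' := by
  funext i
  by_contra hne
  have hSi : S' i = !S i := by
    revert hne
    cases S i <;> cases S' i <;> simp
  -- The two homeomorphisms share `σ`, so `g' ∘ g.symm` fixes indices. It carries the coordinate
  -- `(i, S' i)`, which `S` does not select, to an open condition on the image for `S`.
  have hopen : IsOpen {w : range fun n => twist e S (z n) |
      (g' (g.symm w) : κ → Bool) (e.symm (.inl i)) = true} := by
    refine (isOpen_discrete ({true} : Set Bool)).preimage ?_
    exact (continuous_apply _).comp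
      (continuous_subtype_val.comp (g'.continuous.comp g.symm.continuous))
  obtain ⟨V, hV, hVeq⟩ := isOpen_induced_iff.1 hopen
  refine not_isOpen_of_not_selected hz e S i hV fun m => ?_
  let w : range fun n => twist e S (z n) := ⟨twist e S (z m), m, rfl⟩
  obtain ⟨n, hn⟩ := hrange (g.symm w).2
  have hw : g.symm w = ⟨_, hY n⟩ := Subtype.ext hn.symm
  have hm : σ n = m := by
    apply hinj
    change twist e S (z (σ n)) = twist e S (z m)
    rw [← hg n, ← hw, g.apply_symm_apply]
  have hiff : twist e S (z m) ∈ V ↔ (g' (g.symm w) : κ → Bool) (e.symm (.inl i)) = true := by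
    exact Set.ext_iff.1 hVeq w
  rw [hiff, hw, hg', twist_symm_inl, hm, hSi]

end TwistedFamily

/-! ### Absence of nontrivial convergent sequences. -/

section Separating

variable {I κ : Type*} {z : ℕ × ℕ → (I × Bool) ⊕ I → Bool}

theorem twist_comp_injective
    (hz : ∀ E F : Set (ℕ × ℕ), FinFin E → FinFin F → Disjoint E F →
      ∃ i, (∀ n ∈ E, z n (.inr i) = true) ∧ ∀ n ∈ F, z n (.inr i) = false)
    (e : κ ≃ I ⊕ I) (T : I → Bool) : Function.Injective fun n => twist e T (z n) := by
  intro n m h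
  by_contra hne
  obtain ⟨i, hn, hm⟩ := hz {n} {m} (finFin_singleton n) (finFin_singleton m)
    (disjoint_singleton.2 hne)
  have := congrFun h (e.symm (.inr i))
  simp only [twist_symm_inr, hn n rfl, hm m rfl] at this
  revert this
  cases T i <;> simp

/-- If infinitely many indices occur, two disjoint infinite small sets of them are separated by one
coordinate, which then takes both values infinitely often along the sequence. -/
theorem noNontrivialConvergentSeq_twist
    (hz : ∀ E F : Set (ℕ × ℕ), FinFin E → FinFin F → Disjoint E F →
      ∃ i, (∀ n ∈ E, z n (.inr i) = true) ∧ ∀ n ∈ F, z n (.inr i) = false)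
    (e : κ ≃ I ⊕ I) (T : I → Bool) :
    NoNontrivialConvergentSeq (range fun n => twist e T (z n)) := by
  intro s hs x hx
  choose c hc using hs
  have hc : ∀ k, twist e T (z (c k)) = s k := hc
  by_cases hfin : (range c).Finite
  · have hsfin : (range s).Finite := by
      refine (hfin.image fun n => twist e T (z n)).subset ?_
      rintro _ ⟨k, rfl⟩
      exact ⟨c k, ⟨k, rfl⟩, hc k⟩
    have hev : ∀ᶠ k in atTop, s k = x := by
      have hnhds : (range s \ {x})ᶜ ∈ 𝓝 x :=
        (hsfin.subset sdiff_subset).isClosed.isOpen_compl.mem_nhds fun h => h.2 rfl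
      filter_upwards [hx hnhds] with k hk
      by_contra hne
      exact hk ⟨⟨k, rfl⟩, hne⟩
    obtain ⟨N, hN⟩ := eventually_atTop.1 hev
    exact ⟨N, fun n hn => (hN n hn).trans (hN N le_rfl).symm⟩
  · exfalso
    obtain ⟨B, hBc, hB, hBfin⟩ := Set.Infinite.exists_finFin hfin
    obtain ⟨E, F, hEB, hFB, hEF, hE, hF⟩ := hB.exists_disjoint_infinite
    obtain ⟨i, hiE, hiF⟩ := hz E F (hBfin.mono hEB) (hBfin.mono hFB) hEF
    have hfreq : ∀ G : Set (ℕ × ℕ), G ⊆ range c → G.Infinite → ∃ᶠ k in atTop, c k ∈ G := by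
      intro G hG hGinf
      rw [← Nat.cofinite_eq_atTop, frequently_cofinite_iff_infinite]
      exact hGinf.preimage hG
    have hlim : ∀ᶠ k in atTop, s k (e.symm (.inr i)) = x (e.symm (.inr i)) := by
      have := (continuous_apply (e.symm (.inr i))).continuousAt.tendsto.comp hx
      rw [nhds_discrete, tendsto_pure] at this
      exact this
    obtain ⟨k, hk, hkx⟩ := ((hfreq E (hEB.trans hBc) hE).and_eventually hlim).exists
    obtain ⟨l, hl, hlx⟩ := ((hfreq F (hFB.trans hBc) hF).and_eventually hlim).exists
    have := hkx.trans hlx.symm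
    rw [← hc, ← hc, twist_symm_inr, twist_symm_inr, hiE _ hk, hiF _ hl] at this
    revert this
    cases T i <;> simp

end Separating

/-! ### Choice of the family and the conclusion. -/

/-- There are `2 ^ 𝔠` countable dense subsets of `2 ^ 𝔠` without nontrivial convergent sequences
which are pairwise disjoint and pairwise non-homeomorphic. -/
theorem exists_disjoint_nonhomeomorphic_dense {ι : Type u} {A : Type v} (hι : #ι = 𝔠)
    (hA : #A = 2 ^ 𝔠) :
    ∃ Y : A → Set (ι → Bool),
      (∀ a, (Y a).Countable ∧ Dense (Y a) ∧ NoNontrivialConvergentSeq (Y a)) ∧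
      ∀ a b, a ≠ b → Disjoint (Y a) (Y b) ∧ IsEmpty (Y a ≃ₜ Y b) := by
  have hιι : #ι = #(ι ⊕ ι) := by simp [hι]
  obtain ⟨e⟩ := Cardinal.eq.1 hιι
  have hιB : #(ι × Bool) ≤ 𝔠 := by simp [hι]
  obtain ⟨z, hz, hsep⟩ := exists_denseRange_separating hι hιB
  let y : (ι → Bool) → ℕ × ℕ → ι → Bool := fun T n => twist e T (z n)
  have hinj : ∀ T, Function.Injective (y T) := twist_comp_injective hsep e
  let R : (ι → Bool) → (ι → Bool) → Prop := fun T S =>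
    ¬ Disjoint (range (y T)) (range (y S)) ∨ Nonempty (range (y T) ≃ₜ range (y S))
  have hRsymm : ∀ T S, R T S → R S T := fun T S h =>
    h.imp (fun h h' => h h'.symm) fun ⟨g⟩ => ⟨g.symm⟩
  have hRdisj : ∀ T, #{S | ¬ Disjoint (range (y T)) (range (y S))} ≤ 𝔠 := fun T => by
    have hcount : {S | ¬ Disjoint (range (y T)) (range (y S))}.Countable := by
      -- If point `n` for `T` equals point `m` for `S`, xor with `z m` on the `inr` coordinates
      -- returns `S`.
      refine (countable_range fun nm : (ℕ × ℕ) × (ℕ × ℕ) => fun i =>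
        xor (z nm.2 (.inr i)) (y T nm.1 (e.symm (.inr i)))).mono ?_
      intro S hS
      obtain ⟨_, ⟨n, rfl⟩, m, hm⟩ := not_disjoint_iff.1 hS
      refine ⟨(n, m), funext fun i => ?_⟩
      change xor (z m (.inr i)) (y T n (e.symm (.inr i))) = S i
      rw [← hm]
      simp [y, twist_symm_inr]
    exact hcount.le_aleph0.trans aleph0_le_continuum
  have hRhomeo : ∀ T, #{S | Nonempty (range (y T) ≃ₜ range (y S))} ≤ 𝔠 := fun T => by
    let g : ∀ S : {S | Nonempty (range (y T) ≃ₜ range (y S))}, range (y T) ≃ₜ range (y S) :=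
      fun S => S.2.some
    have hσ : ∀ S : {S | Nonempty (range (y T) ≃ₜ range (y S))}, ∃ σ : ℕ × ℕ → ℕ × ℕ,
        ∀ n, (g S ⟨y T n, mem_range_self n⟩ : ι → Bool) = y S (σ n) := fun S => by
      choose σ hσ using fun n => (g S ⟨y T n, mem_range_self n⟩).2
      exact ⟨σ, fun n => (hσ n).symm⟩
    choose σ hσ using hσ
    have hσinj : Function.Injective σ := fun S S' h =>
      Subtype.ext (twist_eq_of_homeomorph hz e mem_range_self (g S) (g S') Subset.rfl
        (hinj S) (hσ S) (h ▸ hσ S'))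
    have := Cardinal.lift_mk_le_lift_mk_of_injective hσinj
    simpa using this
  have hRsmall : ∀ T, #{S | R T S} ≤ 𝔠 := fun T =>
    calc #{S | R T S} ≤ _ := mk_union_le _ _
      _ ≤ 𝔠 + 𝔠 := add_le_add (hRdisj T) (hRhomeo T)
      _ = 𝔠 := continuum_add_self
  have hcard : #(ι → Bool) = 2 ^ (𝔠 : Cardinal.{u}) := by simp [hι]
  obtain ⟨M, hM, hMR⟩ := exists_pairwise_not_mk_eq R hRsymm aleph0_le_continuum hRsmall
    (hcard ▸ cantor 𝔠)
  have hAM : Cardinal.lift.{u} #A = Cardinal.lift.{v} #M := by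
    rw [hM, hcard, hA]
    simp
  obtain ⟨q⟩ := Cardinal.lift_mk_eq'.1 hAM
  refine ⟨fun a => range (y (q a)), fun a => ⟨countable_range _, denseRange_twist hz e _,
    noNontrivialConvergentSeq_twist hsep e _⟩, fun a b hab => ?_⟩
  have := hMR (q a).2 (q b).2 fun h => hab (q.injective (Subtype.ext h))
  simp only [R, not_or, not_not, not_nonempty_iff] at this
  exact this

theorem theorem3 {ι : Type u} {A : Type v} (hι : #ι = 𝔠) (hA : #A = 2 ^ 𝔠) :
    ∃ Y : A → Set (ι → Bool),
      -- the sets `Y a` are dense countable subsets of `D^𝔠` without convergent sequences,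
      -- pairwise disjoint and pairwise non-homeomorphic
      (∀ a, (Y a).Countable ∧ Dense (Y a) ∧ NoNontrivialConvergentSeq (Y a)) ∧
      (∀ a b, a ≠ b → Disjoint (Y a) (Y b) ∧ IsEmpty (Y a ≃ₜ Y b)) ∧
      -- decompositions of `ω` into infinite sets indexed by `Y a` exist
      (∀ a, ∃ d : ℕ → Y a, IsInfiniteDecomposition d) ∧
      -- and whichever are chosen, the construction gives compactifications of `ω` as desired
      (∀ d : (a : A) → ℕ → Y a, (∀ a, IsInfiniteDecomposition (d a)) →
        (∀ a, IsCompactificationOfOmega (tkachukOmega (d a)) ∧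
          (∃ h : (ι → Bool) ≃ₜ remainder (tkachukOmega (d a)),
            ∀ x, (h x : tkachukSpace (d a)) = tkachukTop (d a) x) ∧
          remainderSeqLimits (tkachukOmega (d a)) = tkachukTop (d a) '' Y a) ∧
        (∀ a b, a ≠ b → IsEmpty (tkachukSpace (d a) ≃ₜ tkachukSpace (d b)))) ∧
      -- the set of sequential limits in the remainder is a topological invariant
      (∀ (K L : Type u) [TopologicalSpace K] [TopologicalSpace L] (e : ℕ → K) (f : ℕ → L),
        IsCompactificationOfOmega e → IsCompactificationOfOmega f →
        ∀ F : K ≃ₜ L, F '' remainderSeqLimits e = remainderSeqLimits f) := by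
  obtain ⟨Y, hY, hYY⟩ := exists_disjoint_nonhomeomorphic_dense hι hA
  refine ⟨Y, hY, hYY, fun a => exists_isInfiniteDecomposition (hY a).1 (hY a).2.1.nonempty,
    fun d hd => ⟨fun a => ⟨isCompactificationOfOmega_tkachukOmega (hY a).2.1 (hd a),
      exists_homeomorph_remainder_tkachukOmega (d a),
      remainderSeqLimits_tkachukOmega (hY a).2.2 (hd a)⟩, fun a b hab => ⟨fun F => ?_⟩⟩,
    fun K L _ _ e f he hf F => F.image_remainderSeqLimits he hf⟩
  obtain ⟨g⟩ := nonempty_homeomorph_of_tkachukSpace (hY a).2.1 (hY b).2.1 (hY a).2.2 (hY b).2.2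
    (hd a) (hd b) F
  exact (hYY a b hab).2.false g
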